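/- Let $\kappa$ be a regular cardinal and let $\lambda<\kappa$ be an infinite cardinal. A $\lambda$-indexed chain in a category is a functor from $\lambda$, viewed as a well-ordered set and hence as a category. Let $\mathsf A$, $\mathsf B$, $\mathsf C$ be $\kappa$-accessible categories in which all $\lambda$-indexed chains have colimits. Let $\Theta_{\mathsf A}\colon\mathsf A\to\mathsf C$ and $\Theta_{\mathsf B}\colon\mathsf B\to\mathsf C$ be functors that preserve $\kappa$-directed colimits and colimits of $\lambda$-indexed chains and take $\kappa$-presentable objects to $\kappa$-presentable objects. Let $\mathsf D$ be the pseudopullback of $\Theta_{\mathsf A}$ and $\Theta_{\mathsf B}$: its objects are the triples $(A,B,\theta)$ with $A\in\mathsf A$, $B\in\mathsf B$ and $\theta\colon\Theta_{\mathsf A}(A)\to\Theta_{\mathsf B}(B)$ an isomorphism in $\mathsf C$, and its morphisms $(A,B,\theta)\to(A',B',\theta')$ are the pairs of morphisms $f\colon A\to A'$, $g\colon B\to B'$ such that $\theta'\circ\Theta_{\mathsf A}(f)=\Theta_{\mathsf B}(g)\circ\theta$. Then the category $\mathsf D$ is $\kappa$-accessible, and an object $(A,B,\theta)$ of $\mathsf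 D$ is $\kappa$-presentable in $\mathsf D$ if and only if $A$ is $\kappa$-presentable in $\mathsf A$ and $B$ is $\kappa$-presentable in $\mathsf B$. -/

import Mathlib

open CategoryTheory CategoryTheory.Limits

universe w v₁ v₂ v₃ u₁ u₂ u₃

/-! The heart of the matter is that every object (A, B, θ) is well approximated by objects with
κ-presentable components. Write A and B as colimits of κ-presentable objects A_a, B_a over one
κ-directed poset. The objects Θ_A(A_a) and Θ_B(B_a) are κ-presentable, so θ and its inverse
restrict, stage by stage, to maps into later stages; these are natural and mutually inverse only
after moving further up. As λ < κ, all the required moves can be built into a chain of length λ in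
the poset (`exists_chain_shift`). Along it the two diagrams interleave. The colimits A', B' over the
chain are κ-presentable, being λ-small colimits of κ-presentables, and since Θ_A and Θ_B preserve
them, the interleaving becomes an isomorphism Θ_A(A') ≅ Θ_B(B') (`exists_hom_of_map_hom`).

Starting the chain high enough, one can factor fewer than κ given maps through such an
approximation, or make it coequalize given maps. Hence the comma category of componentwise
presentable objects over (A, B, θ) is κ-filtered, and its projections to the canonical diagrams of A
and B are final. Colimits are detected componentwise, so (A, B, θ) is the colimit of this diagram.
Componentwise presentable objects are presentable because κ-filtered colimits are computed
componentwise; conversely, a presentable object is a retract of one from the generating class. -/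

namespace CategoryTheory

/-! ### Chains in κ-directed preorders. -/

section Chains

variable {κ : Cardinal.{w}} [Fact κ.IsRegular] {γ : Type w} [Preorder γ] [IsCardinalFiltered γ κ]

/-- Fewer than `κ` elements of a `κ`-directed preorder have an upper bound. -/
lemma exists_upper_bound_of_isCardinalFiltered {K : Type u₁} (hK : HasCardinalLT K κ) (a : K → γ) :
    ∃ b, ∀ k, a k ≤ b :=
  ⟨IsCardinalFiltered.max a hK, fun k ↦ leOfHom (IsCardinalFiltered.toMax a hK k)⟩

lemma exists_upper_bound_pair (κ : Cardinal.{w}) [Fact κ.IsRegular] {γ : Type w} [Preorder γ]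
    [IsCardinalFiltered γ κ] (a b : γ) : ∃ c, a ≤ c ∧ b ≤ c := by
  obtain ⟨c, hc⟩ := exists_upper_bound_of_isCardinalFiltered
    (κ := κ) (hasCardinalLT_of_finite Bool κ (Cardinal.IsRegular.aleph0_le Fact.out))
    (fun x ↦ cond x a b)
  exact ⟨c, hc true, hc false⟩

/-- In a `κ`-directed preorder, there are chains of any length of cardinality less than `κ`
which are closed under a given binary operation. -/
lemma exists_chain_of_isCardinalFiltered {I : Type w} [LinearOrder I] [WellFoundedLT I]
    (hI : HasCardinalLT I κ) (Φ : γ → γ → γ) (hΦ : ∀ p q, q ≤ Φ p q) (r : γ) :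
    ∃ s : I → γ, Monotone s ∧ (∀ i, r ≤ s i) ∧ ∀ i k j, i < j → k < j → Φ (s i) (s k) ≤ s j := by
  have hκ : Cardinal.aleph0 ≤ κ := Cardinal.IsRegular.aleph0_le Fact.out
  have bound (j : I) (f : Set.Iio j → γ) :
      ∃ b, r ≤ b ∧ ∀ x y, Φ (f x) (f y) ≤ b := by
    have hj : HasCardinalLT (Set.Iio j) κ := hI.of_injective _ Subtype.val_injective
    -- The extra index `none` keeps the chain above `r`. Limit stages need only an upper bound, so
    -- the chain need not be continuous.
    obtain ⟨b, hb⟩ := exists_upper_bound_of_isCardinalFiltered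
      ((hasCardinalLT_option_iff _ κ hκ).2 (hasCardinalLT_prod hκ hj hj))
      (fun o ↦ o.elim r (fun x ↦ Φ (f x.1) (f x.2)))
    exact ⟨b, hb none, fun x y ↦ hb (some (x, y))⟩
  choose B hB₁ hB₂ using bound
  let s : I → γ := wellFounded_lt.fix (fun j f ↦ B j (fun x ↦ f x.1 x.2))
  have hs (j : I) : s j = B j (fun x ↦ s x.1) := wellFounded_lt.fix_eq _ j
  have h (i k j : I) (hi : i < j) (hk : k < j) : Φ (s i) (s k) ≤ s j := by
    rw [hs j]
    exact hB₂ j (fun x ↦ s x.1) ⟨i, hi⟩ ⟨k, hk⟩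
  refine ⟨s, fun i j hij ↦ ?_, fun i ↦ by rw [hs]; exact hB₁ _ _, h⟩
  obtain rfl | hij := hij.eq_or_lt
  · rfl
  · exact (hΦ _ _).trans (h i i j hij hij)

end Chains

/-! ### Interleaved chains and their colimits. -/

section Interleaving

variable {C : Type u₃} [Category.{v₃} C] {I : Type u₁} [LinearOrder I]
  {F G : I ⥤ C}

/-- The data of compatible morphisms `F i ⟶ G j` for all `i < j`. -/
structure Shift (F G : I ⥤ C) where
  hom {i j : I} (h : i < j) : F.obj i ⟶ G.obj j
  hom_map {i j k : I} (h : i < j) (h' : j ≤ k) :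
    hom h ≫ G.map (homOfLE h') = hom (h.trans_le h')
  map_hom {i j k : I} (h : i ≤ j) (h' : j < k) :
    F.map (homOfLE h) ≫ hom h' = hom (h.trans_lt h')

namespace Shift

lemma hom_ι (S : Shift F G) (d : Cocone G) {i j k : I} (hj : i < j) (hk : i < k) :
    S.hom hj ≫ d.ι.app j = S.hom hk ≫ d.ι.app k := by
  rw [← d.w (homOfLE (le_max_left j k)), ← d.w (homOfLE (le_max_right j k)), ← Category.assoc,
    ← Category.assoc, S.hom_map, S.hom_map]

variable [NoMaxOrder I]

/-- The cocone for `F` induced by a cocone for `G` and a shift. -/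
noncomputable def cocone (S : Shift F G) (d : Cocone G) : Cocone F where
  pt := d.pt
  ι :=
    { app i := S.hom (exists_gt i).choose_spec ≫ d.ι.app _
      naturality i j f := by
        have hj := (exists_gt j).choose_spec
        dsimp
        rw [Category.comp_id, S.hom_ι d (exists_gt i).choose_spec ((leOfHom f).trans_lt hj),
          ← S.map_hom (leOfHom f) hj, Category.assoc]
        rfl }

/-- The morphism between colimits induced by a shift. -/
noncomputable def desc (S : Shift F G) {c : Cocone F} (hc : IsColimit c) (d : Cocone G) :
    c.pt ⟶ d.pt :=
  hc.desc (S.cocone d)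

lemma ι_desc (S : Shift F G) {c : Cocone F} (hc : IsColimit c) (d : Cocone G) {i j : I}
    (h : i < j) : c.ι.app i ≫ S.desc hc d = S.hom h ≫ d.ι.app j := by
  exact (hc.fac (S.cocone d) i).trans (S.hom_ι d _ h)

lemma desc_comp_desc (S : Shift F G) (T : Shift G F)
    (h : ∀ {i j k : I} (h : i < j) (h' : j < k),
      S.hom h ≫ T.hom h' = F.map (homOfLE (h.le.trans h'.le)))
    {c : Cocone F} (hc : IsColimit c) {d : Cocone G} (hd : IsColimit d) :
    S.desc hc d ≫ T.desc hd c = 𝟙 c.pt := by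
  refine hc.hom_ext fun i ↦ ?_
  obtain ⟨j, hj⟩ := exists_gt i
  obtain ⟨k, hk⟩ := exists_gt j
  rw [reassoc_of% (S.ι_desc hc d hj), T.ι_desc hd c hk, ← Category.assoc, h, c.w, Category.comp_id]

/-- The isomorphism between colimits induced by two shifts which are inverse to each other. -/
noncomputable def iso (S : Shift F G) (T : Shift G F)
    (h₁ : ∀ {i j k : I} (h : i < j) (h' : j < k),
      S.hom h ≫ T.hom h' = F.map (homOfLE (h.le.trans h'.le)))
    (h₂ : ∀ {i j k : I} (h : i < j) (h' : j < k),
      T.hom h ≫ S.hom h' = G.map (homOfLE (h.le.trans h'.le)))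
    {c : Cocone F} (hc : IsColimit c) {d : Cocone G} (hd : IsColimit d) : c.pt ≅ d.pt where
  hom := S.desc hc d
  inv := T.desc hd c
  hom_inv_id := S.desc_comp_desc T h₁ hc hd
  inv_hom_id := T.desc_comp_desc S h₂ hd hc

end Shift

end Interleaving

/-! ### Matching directed diagrams of presentable objects. -/

section

variable {C : Type u₃} [Category.{v₃} C] {γ : Type w} [Preorder γ]

lemma map_homOfLE_comp (G : γ ⥤ C) {a b c : γ} (h : a ≤ b) (h' : b ≤ c) :
    G.map (homOfLE h) ≫ G.map (homOfLE h') = G.map (homOfLE (h.trans h')) := by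
  rw [← G.map_comp]
  rfl

lemma comp_map_homOfLE_eq_of_le {G : γ ⥤ C} {P : C} {a b r : γ} {f : P ⟶ G.obj a} {g : P ⟶ G.obj b}
    {ha : a ≤ r} {hb : b ≤ r} (h : f ≫ G.map (homOfLE ha) = g ≫ G.map (homOfLE hb))
    {r' : γ} (hr : r ≤ r') :
    f ≫ G.map (homOfLE (ha.trans hr)) = g ≫ G.map (homOfLE (hb.trans hr)) := by
  rw [← map_homOfLE_comp G ha hr, ← map_homOfLE_comp G hb hr, ← Category.assoc, h, Category.assoc]

variable {κ : Cardinal.{w}} [Fact κ.IsRegular] [IsCardinalFiltered γ κ]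

lemma exists_comp_map_homOfLE_eq {G : γ ⥤ C} {c : Cocone G} (hc : IsColimit c) {P : C}
    (hP : IsCardinalPresentable P κ) {a b : γ} (f : P ⟶ G.obj a) (g : P ⟶ G.obj b)
    (h : f ≫ c.ι.app a = g ≫ c.ι.app b) :
    ∃ (r : γ) (ha : a ≤ r) (hb : b ≤ r), f ≫ G.map (homOfLE ha) = g ≫ G.map (homOfLE hb) := by
  obtain ⟨r, u, v, huv⟩ := IsCardinalPresentable.exists_eq_of_isColimit κ hc f g h
  exact ⟨r, leOfHom u, leOfHom v, huv⟩

lemma exists_comp_ι_eq {G : γ ⥤ C} {c : Cocone G} (hc : IsColimit c) {P : C}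
    (hP : IsCardinalPresentable P κ) (f : P ⟶ c.pt) (a : γ) :
    ∃ (r : γ) (_ : a ≤ r) (g : P ⟶ G.obj r), g ≫ c.ι.app r = f := by
  obtain ⟨b, g, hg⟩ := IsCardinalPresentable.exists_hom_of_isColimit κ hc f
  obtain ⟨r, ha, hb⟩ := exists_upper_bound_pair κ a b
  exact ⟨r, ha, g ≫ G.map (homOfLE hb), by rw [Category.assoc, c.w, hg]⟩

/-- Two directed diagrams of `κ`-presentable objects with the same colimit become isomorphic
after restriction to suitable long enough chains and passage to the colimit. -/
lemma exists_chain_shift {F G : γ ⥤ C} {c : Cocone F} (hc : IsColimit c) {d : Cocone G}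
    (hd : IsColimit d) (e : c.pt ≅ d.pt) (hF : ∀ p, IsCardinalPresentable (F.obj p) κ)
    (hG : ∀ p, IsCardinalPresentable (G.obj p) κ)
    {I : Type w} [LinearOrder I] [WellFoundedLT I] (hI : HasCardinalLT I κ)
    {p₀ q₀ : γ} (hpq : p₀ ≤ q₀) (u₀ : F.obj p₀ ⟶ G.obj q₀)
    (hu₀ : u₀ ≫ d.ι.app q₀ = c.ι.app p₀ ≫ e.hom) :
    ∃ (s : I → γ) (hs : Monotone s) (hq : ∀ i, q₀ ≤ s i)
      (S : Shift (hs.functor ⋙ F) (hs.functor ⋙ G)) (T : Shift (hs.functor ⋙ G) (hs.functor ⋙ F)),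
      (∀ {i j k : I} (h : i < j) (h' : j < k),
        S.hom h ≫ T.hom h' = F.map (homOfLE (hs (h.le.trans h'.le)))) ∧
      (∀ {i j k : I} (h : i < j) (h' : j < k),
        T.hom h ≫ S.hom h' = G.map (homOfLE (hs (h.le.trans h'.le)))) ∧
      (∀ {i j : I} (h : i < j), S.hom h ≫ d.ι.app (s j) = c.ι.app (s i) ≫ e.hom) ∧
      (∀ {i j : I} (h : i < j), F.map (homOfLE (hpq.trans (hq i))) ≫ S.hom h =
        u₀ ≫ G.map (homOfLE (hq j))) := by
  -- Presentability restricts `e` and its inverse to a common later stage `n p`, with no naturality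
  -- yet.
  have aux (p : γ) : ∃ (n : γ) (_ : p ≤ n) (u : F.obj p ⟶ G.obj n) (v : G.obj p ⟶ F.obj n),
      u ≫ d.ι.app n = c.ι.app p ≫ e.hom ∧ v ≫ c.ι.app n = d.ι.app p ≫ e.inv := by
    obtain ⟨a, ha, u, hu⟩ := exists_comp_ι_eq hd (hF p) (c.ι.app p ≫ e.hom) p
    obtain ⟨b, hb, v, hv⟩ := exists_comp_ι_eq hc (hG p) (d.ι.app p ≫ e.inv) a
    exact ⟨b, ha.trans hb, u ≫ G.map (homOfLE hb), v, by rw [Category.assoc, d.w, hu], hv⟩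
  choose n hn u v hu hv using aux
  have natu (p q : γ) (h : p ≤ q) : ∃ (r : γ) (h₁ : n p ≤ r) (h₂ : n q ≤ r),
      u p ≫ G.map (homOfLE h₁) = (F.map (homOfLE h) ≫ u q) ≫ G.map (homOfLE h₂) :=
    -- Both sides agree in the colimit, hence at some stage; the same argument gives the next three
    -- claims.
    exists_comp_map_homOfLE_eq hd (hF p) _ _ (by
      rw [Category.assoc, hu, hu, c.w_assoc])
  have natv (p q : γ) (h : p ≤ q) : ∃ (r : γ) (h₁ : n p ≤ r) (h₂ : n q ≤ r),
      v p ≫ F.map (homOfLE h₁) = (G.map (homOfLE h) ≫ v q) ≫ F.map (homOfLE h₂) :=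
    exists_comp_map_homOfLE_eq hc (hG p) _ _ (by
      rw [Category.assoc, hv, hv, d.w_assoc])
  have invu (p q : γ) (h : n p ≤ q) : ∃ (r : γ) (h₁ : n q ≤ r) (h₂ : p ≤ r),
      (u p ≫ G.map (homOfLE h) ≫ v q) ≫ F.map (homOfLE h₁) = 𝟙 _ ≫ F.map (homOfLE h₂) :=
    exists_comp_map_homOfLE_eq hc (hF p) _ _ (by
      rw [Category.assoc, Category.assoc, hv, d.w_assoc, reassoc_of% (hu p)]
      simp)
  have invv (p q : γ) (h : n p ≤ q) : ∃ (r : γ) (h₁ : n q ≤ r) (h₂ : p ≤ r),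
      (v p ≫ F.map (homOfLE h) ≫ u q) ≫ G.map (homOfLE h₁) = 𝟙 _ ≫ G.map (homOfLE h₂) :=
    exists_comp_map_homOfLE_eq hd (hG p) _ _ (by
      rw [Category.assoc, Category.assoc, hu, c.w_assoc, reassoc_of% (hv p)]
      simp)
  -- One bound for all four relations. Quantifying over `r'` makes them persist at every later
  -- stage.
  have aux (p q : γ) : ∃ r, q ≤ r ∧ n p ≤ r ∧ n q ≤ r ∧
      (∀ r', r ≤ r' → ∀ (h : p ≤ q) (h₁ : n p ≤ r') (h₂ : n q ≤ r'),
        u p ≫ G.map (homOfLE h₁) = (F.map (homOfLE h) ≫ u q) ≫ G.map (homOfLE h₂)) ∧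
      (∀ r', r ≤ r' → ∀ (h : p ≤ q) (h₁ : n p ≤ r') (h₂ : n q ≤ r'),
        v p ≫ F.map (homOfLE h₁) = (G.map (homOfLE h) ≫ v q) ≫ F.map (homOfLE h₂)) ∧
      (∀ r', r ≤ r' → ∀ (h : n p ≤ q) (h₁ : n q ≤ r') (h₂ : p ≤ r'),
        (u p ≫ G.map (homOfLE h) ≫ v q) ≫ F.map (homOfLE h₁) = 𝟙 _ ≫ F.map (homOfLE h₂)) ∧
      (∀ r', r ≤ r' → ∀ (h : n p ≤ q) (h₁ : n q ≤ r') (h₂ : p ≤ r'),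
        (v p ≫ F.map (homOfLE h) ≫ u q) ≫ G.map (homOfLE h₁) = 𝟙 _ ≫ G.map (homOfLE h₂)) := by
    have pick {Q : Prop} {R : γ → Q → Prop} (h : ∀ hQ : Q, ∃ r, R r hQ) :
        ∃ r, ∀ hQ : Q, R r hQ := by
      by_cases hQ : Q
      · exact (h hQ).imp fun r hr _ ↦ hr
      -- A junk value: the relation is only demanded when `Q` holds.
      · exact ⟨p, fun h ↦ (hQ h).elim⟩
    obtain ⟨a₁, ha₁⟩ := pick (natu p q)
    obtain ⟨a₂, ha₂⟩ := pick (natv p q)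
    obtain ⟨a₃, ha₃⟩ := pick (invu p q)
    obtain ⟨a₄, ha₄⟩ := pick (invv p q)
    obtain ⟨b₁, h₁, h₂⟩ := exists_upper_bound_pair κ a₁ a₂
    obtain ⟨b₂, h₃, h₄⟩ := exists_upper_bound_pair κ a₃ a₄
    obtain ⟨b₃, h₅, h₆⟩ := exists_upper_bound_pair κ (n p) (n q)
    obtain ⟨b₄, h₇, h₈⟩ := exists_upper_bound_pair κ b₁ b₂
    obtain ⟨b, h₉, h₁₀⟩ := exists_upper_bound_pair κ b₃ b₄
    refine ⟨b, (hn q).trans (h₆.trans h₉), h₅.trans h₉, h₆.trans h₉, ?_, ?_, ?_, ?_⟩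
    · intro r hr h _ _
      obtain ⟨_, _, H⟩ := ha₁ h
      exact comp_map_homOfLE_eq_of_le H (h₁.trans (h₇.trans (h₁₀.trans hr)))
    · intro r hr h _ _
      obtain ⟨_, _, H⟩ := ha₂ h
      exact comp_map_homOfLE_eq_of_le H (h₂.trans (h₇.trans (h₁₀.trans hr)))
    · intro r hr h _ _
      obtain ⟨_, _, H⟩ := ha₃ h
      exact comp_map_homOfLE_eq_of_le H (h₃.trans (h₈.trans (h₁₀.trans hr)))
    · intro r hr h _ _
      obtain ⟨_, _, H⟩ := ha₄ h
      exact comp_map_homOfLE_eq_of_le H (h₄.trans (h₈.trans (h₁₀.trans hr)))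
  choose Φ hΦ hΦ₁ _ hnatu hnatv hinvu hinvv using aux
  have init (q : γ) (h : p₀ ≤ q) : ∃ (r : γ) (h₁ : n q ≤ r) (h₂ : q₀ ≤ r),
      (F.map (homOfLE h) ≫ u q) ≫ G.map (homOfLE h₁) = u₀ ≫ G.map (homOfLE h₂) :=
    exists_comp_map_homOfLE_eq hd (hF p₀) _ _ (by
      rw [Category.assoc, hu, hu₀, c.w_assoc])
  have aux (p q : γ) : ∃ r, Φ p q ≤ r ∧ ∀ r', r ≤ r' → ∀ (h : p₀ ≤ q) (h₁ : n q ≤ r') (h₂ : q₀ ≤ r'),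
      (F.map (homOfLE h) ≫ u q) ≫ G.map (homOfLE h₁) = u₀ ≫ G.map (homOfLE h₂) := by
    by_cases h : p₀ ≤ q
    · obtain ⟨a, _, _, ha⟩ := init q h
      obtain ⟨b, h₁, h₂⟩ := exists_upper_bound_pair κ (Φ p q) a
      exact ⟨b, h₁, fun r hr _ _ _ ↦ comp_map_homOfLE_eq_of_le ha (h₂.trans hr)⟩
    · exact ⟨Φ p q, le_rfl, fun _ _ h' ↦ (h h').elim⟩
  choose Ψ hΨ hinit using aux
  -- Closure under `Ψ` makes every relation between two earlier stages hold strictly at each later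
  -- stage of the chain.
  obtain ⟨s, hs, hqs, hsΨ⟩ := exists_chain_of_isCardinalFiltered hI Ψ
    (fun p q ↦ (hΦ p q).trans (hΨ p q)) q₀
  have hsΦ (i k j : I) (hi : i < j) (hk : k < j) : Φ (s i) (s k) ≤ s j :=
    (hΨ _ _).trans (hsΨ i k j hi hk)
  have hsn (i j : I) (h : i < j) : n (s i) ≤ s j := (hΦ₁ _ _).trans (hsΦ i i j h h)
  refine ⟨s, hs, hqs,
    { hom {i j} h := u (s i) ≫ G.map (homOfLE (hsn i j h))
      hom_map {i j k} h h' := (Category.assoc _ _ _).trans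
        (congrArg (u (s i) ≫ ·) (map_homOfLE_comp G (hsn i j h) (hs h')))
      map_hom {i j k} h h' :=
        (Category.assoc _ _ _).symm.trans
          (hnatu (s i) (s j) _ (hsΦ i j k (h.trans_lt h') h') (hs h) _ _).symm },
    { hom {i j} h := v (s i) ≫ F.map (homOfLE (hsn i j h))
      hom_map {i j k} h h' := (Category.assoc _ _ _).trans
        (congrArg (v (s i) ≫ ·) (map_homOfLE_comp F (hsn i j h) (hs h')))
      map_hom {i j k} h h' :=
        (Category.assoc _ _ _).symm.trans
          (hnatv (s i) (s j) _ (hsΦ i j k (h.trans_lt h') h') (hs h) _ _).symm },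
    ?_, ?_, ?_, ?_⟩
  · intro i j k h h'
    have := hinvu (s i) (s j) _ (hsΦ i j k (h.trans h') h') (hsn i j h) (hsn j k h')
      (hs (h.trans h').le)
    rw [Category.id_comp, Category.assoc, Category.assoc] at this
    exact (Category.assoc _ _ _).trans this
  · intro i j k h h'
    have := hinvv (s i) (s j) _ (hsΦ i j k (h.trans h') h') (hsn i j h) (hsn j k h')
      (hs (h.trans h').le)
    rw [Category.id_comp, Category.assoc, Category.assoc] at this
    exact (Category.assoc _ _ _).trans this
  · intro i j h
    dsimp
    rw [Category.assoc, d.w, hu]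
  · intro i j h
    exact (Category.assoc _ _ _).symm.trans
      (hinit (s i) (s i) _ (hsΨ i i j h h) (hpq.trans (hqs i)) _ _)

end

end CategoryTheory

/-! ### Colimits, smallness and presentability in the pseudopullback. -/

namespace CategoryTheory.Limits.CategoricalPullback

variable {A : Type u₁} [Category.{v₁} A] {B : Type u₂} [Category.{v₂} B]
  {C : Type u₃} [Category.{v₃} C] {L : A ⥤ C} {R : B ⥤ C}

section Colimits

variable {J : Type*} [Category* J] {K : J ⥤ CategoricalPullback L R}

lemma map_comp_iso_hom_eq_of_isColimit {c : Cocone K} (h : IsColimit (L.mapCocone ((π₁ L R).mapCocone c)))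
    (s : Cocone K) (a : c.pt.fst ⟶ s.pt.fst) (b : c.pt.snd ⟶ s.pt.snd)
    (ha : ∀ j, (c.ι.app j).fst ≫ a = (s.ι.app j).fst)
    (hb : ∀ j, (c.ι.app j).snd ≫ b = (s.ι.app j).snd) :
    L.map a ≫ s.pt.iso.hom = c.pt.iso.hom ≫ R.map b :=
  h.hom_ext fun j ↦ by
    change L.map (c.ι.app j).fst ≫ L.map a ≫ s.pt.iso.hom =
      L.map (c.ι.app j).fst ≫ c.pt.iso.hom ≫ R.map b
    rw [← L.map_comp_assoc, ha]
    refine (s.ι.app j).w.trans ((Hom.w_assoc (c.ι.app j) (R.map b)).trans ?_).symm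
    rw [← R.map_comp, hb]

/-- A cocone in a categorical pullback is colimit when its two projections are,
provided the first of them is preserved. -/
noncomputable def isColimitOfProj {c : Cocone K} (h₁ : IsColimit ((π₁ L R).mapCocone c))
    (h₂ : IsColimit ((π₂ L R).mapCocone c)) [PreservesColimit (K ⋙ π₁ L R) L] :
    IsColimit c where
  desc s :=
    { fst := h₁.desc ((π₁ L R).mapCocone s)
      snd := h₂.desc ((π₂ L R).mapCocone s)
      w := map_comp_iso_hom_eq_of_isColimit (isColimitOfPreserves L h₁) s _ _
        (h₁.fac ((π₁ L R).mapCocone s)) (h₂.fac ((π₂ L R).mapCocone s)) }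
  fac s j := by
    ext
    · exact h₁.fac ((π₁ L R).mapCocone s) j
    · exact h₂.fac ((π₂ L R).mapCocone s) j
  uniq s m hm := by
    ext
    · exact h₁.uniq ((π₁ L R).mapCocone s) _ fun j ↦ congrArg Hom.fst (hm j)
    · exact h₂.uniq ((π₂ L R).mapCocone s) _ fun j ↦ congrArg Hom.snd (hm j)

variable (K) in
/-- The comparison between the two projections of a diagram in a categorical pullback. -/
@[simps!]
def diagramIso : (K ⋙ π₁ L R) ⋙ L ≅ (K ⋙ π₂ L R) ⋙ R :=
  NatIso.ofComponents (fun j ↦ (K.obj j).iso) (fun f ↦ (K.map f).w)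

variable {c₁ : Cocone (K ⋙ π₁ L R)} (h₁ : IsColimit c₁) {c₂ : Cocone (K ⋙ π₂ L R)}
  (h₂ : IsColimit c₂) [PreservesColimit (K ⋙ π₁ L R) L] [PreservesColimit (K ⋙ π₂ L R) R]

/-- The cocone in a categorical pullback assembled from colimits of the two projections. -/
noncomputable def coconeOfProj : Cocone K where
  pt :=
    { fst := c₁.pt
      snd := c₂.pt
      iso := IsColimit.coconePointsIsoOfNatIso (isColimitOfPreserves L h₁)
        (isColimitOfPreserves R h₂) (diagramIso K) }
  ι :=
    { app j :=
        { fst := c₁.ι.app j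
          snd := c₂.ι.app j
          w := (IsColimit.comp_coconePointsIsoOfNatIso_hom (isColimitOfPreserves L h₁)
            (isColimitOfPreserves R h₂) (diagramIso K) j) }
      naturality i j f := by
        ext
        · exact c₁.ι.naturality f
        · exact c₂.ι.naturality f }

/-- The cocone `coconeOfProj` is colimit. -/
noncomputable def isColimitCoconeOfProj : IsColimit (coconeOfProj h₁ h₂) :=
  isColimitOfProj h₁ h₂

variable (J)

lemma hasColimitsOfShape [HasColimitsOfShape J A] [HasColimitsOfShape J B]
    [PreservesColimitsOfShape J L] [PreservesColimitsOfShape J R] :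
    HasColimitsOfShape J (CategoricalPullback L R) where
  has_colimit K := ⟨_, isColimitCoconeOfProj (colimit.isColimit (K ⋙ π₁ L R))
    (colimit.isColimit (K ⋙ π₂ L R))⟩

lemma preservesColimitsOfShape_π₁ [HasColimitsOfShape J A] [HasColimitsOfShape J B]
    [PreservesColimitsOfShape J L] [PreservesColimitsOfShape J R] :
    PreservesColimitsOfShape J (π₁ L R) where
  preservesColimit {K} := preservesColimit_of_preserves_colimit_cocone
    (isColimitCoconeOfProj (colimit.isColimit (K ⋙ π₁ L R)) (colimit.isColimit (K ⋙ π₂ L R)))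
    (colimit.isColimit (K ⋙ π₁ L R))

lemma preservesColimitsOfShape_π₂ [HasColimitsOfShape J A] [HasColimitsOfShape J B]
    [PreservesColimitsOfShape J L] [PreservesColimitsOfShape J R] :
    PreservesColimitsOfShape J (π₂ L R) where
  preservesColimit {K} := preservesColimit_of_preserves_colimit_cocone
    (isColimitCoconeOfProj (colimit.isColimit (K ⋙ π₁ L R)) (colimit.isColimit (K ⋙ π₂ L R)))
    (colimit.isColimit (K ⋙ π₂ L R))

end Colimits

section Small

instance [LocallySmall.{w} A] [LocallySmall.{w} B] :
    LocallySmall.{w} (CategoricalPullback L R) where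
  hom_small X Y := small_of_injective (β := (X.fst ⟶ Y.fst) × (X.snd ⟶ Y.snd))
    (f := fun f ↦ (f.fst, f.snd)) fun f g h ↦ by
      ext
      · exact congrArg _root_.Prod.fst h
      · exact congrArg _root_.Prod.snd h

/-- Up to isomorphism an object is given by small representatives of its components and an
isomorphism in a locally small category. -/
lemma essentiallySmall_inf_inverseImage (P : ObjectProperty A) (Q : ObjectProperty B)
    [ObjectProperty.EssentiallySmall.{w} P] [ObjectProperty.EssentiallySmall.{w} Q]
    [LocallySmall.{w} C] :
    ObjectProperty.EssentiallySmall.{w} (P.inverseImage (π₁ L R) ⊓ Q.inverseImage (π₂ L R)) := by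
  obtain ⟨P', _, hP'⟩ := ObjectProperty.EssentiallySmall.exists_small_le' P
  obtain ⟨Q', _, hQ'⟩ := ObjectProperty.EssentiallySmall.exists_small_le' Q
  have (X Y : C) : Small.{w} (X ≅ Y) :=
    small_of_injective (β := X ⟶ Y) (f := Iso.hom) fun _ _ h ↦ Iso.ext h
  let φ (x : Σ (X : Subtype P') (Y : Subtype Q'), L.obj X.1 ≅ R.obj Y.1) :
    CategoricalPullback L R := ⟨x.1.1, x.2.1.1, x.2.2⟩
  refine ⟨.ofObj φ, inferInstance, ?_⟩
  rintro X ⟨h₁, h₂⟩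
  obtain ⟨S, hS, ⟨e₁⟩⟩ := hP' _ h₁
  obtain ⟨T, hT, ⟨e₂⟩⟩ := hQ' _ h₂
  change X.fst ≅ S at e₁
  change X.snd ≅ T at e₂
  let x : Σ (X : Subtype P') (Y : Subtype Q'), L.obj X.1 ≅ R.obj Y.1 :=
    ⟨⟨S, hS⟩, ⟨T, hT⟩, L.mapIso e₁.symm ≪≫ X.iso ≪≫ R.mapIso e₂⟩
  exact ⟨φ x, ⟨x⟩, ⟨mkIso (y := φ x) e₁ e₂ (by simp [φ, x, ← L.map_comp_assoc])⟩⟩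

end Small

section Presentable

variable (κ : Cardinal.{w}) [Fact κ.IsRegular]

lemma hasCardinalFilteredColimits [HasCardinalFilteredColimits A κ] [HasCardinalFilteredColimits B κ]
    [L.IsCardinalAccessible κ] [R.IsCardinalAccessible κ] :
    HasCardinalFilteredColimits (CategoricalPullback L R) κ where
  hasColimitsOfShape J _ _ := by
    have := HasCardinalFilteredColimits.hasColimitsOfShape A κ J
    have := HasCardinalFilteredColimits.hasColimitsOfShape B κ J
    have := L.preservesColimitsOfShape_of_isCardinalAccessible κ J
    have := R.preservesColimitsOfShape_of_isCardinalAccessible κ J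
    exact hasColimitsOfShape J

lemma isCardinalPresentable_of_proj [HasCardinalFilteredColimits A κ]
    [HasCardinalFilteredColimits B κ] [L.IsCardinalAccessible κ] [R.IsCardinalAccessible κ]
    (X : CategoricalPullback L R) [IsCardinalPresentable X.fst κ] [IsCardinalPresentable X.snd κ]
    [IsCardinalPresentable (L.obj X.fst) κ] : IsCardinalPresentable X κ where
  preservesColimitOfShape J _ _ := ⟨fun {K} ↦ ⟨fun {c} hc ↦ ⟨by
    have := HasCardinalFilteredColimits.hasColimitsOfShape A κ J
    have := HasCardinalFilteredColimits.hasColimitsOfShape B κ J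
    have := L.preservesColimitsOfShape_of_isCardinalAccessible κ J
    have := R.preservesColimitsOfShape_of_isCardinalAccessible κ J
    have := preservesColimitsOfShape_π₁ (L := L) (R := R) J
    have := preservesColimitsOfShape_π₂ (L := L) (R := R) J
    have h₁ := isColimitOfPreserves (π₁ L R) hc
    have h₂ := isColimitOfPreserves (π₂ L R) hc
    have h₃ := isColimitOfPreserves R h₂
    have := essentiallySmallSelf J
    have := isFiltered_of_isCardinalFiltered J κ
    refine Types.FilteredColimit.isColimitOf' _ _ (fun f ↦ ?_) (fun j f g hfg ↦ ?_)
    · change X ⟶ c.pt at f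
      obtain ⟨i₁, a₁, ha₁⟩ : ∃ (i : J) (a : X.fst ⟶ (K.obj i).fst),
        a ≫ (c.ι.app i).fst = f.fst := IsCardinalPresentable.exists_hom_of_isColimit κ h₁ f.fst
      obtain ⟨i₂, a₂, ha₂⟩ : ∃ (i : J) (a : X.snd ⟶ (K.obj i).snd),
        a ≫ (c.ι.app i).snd = f.snd := IsCardinalPresentable.exists_hom_of_isColimit κ h₂ f.snd
      -- The two component lifts are compatible only in the colimit. The square is an equation
      -- between maps out of `L.obj X.fst`, so presentability of that object makes it commute at a
      -- later stage.
      have e : (L.map a₁ ≫ (K.obj i₁).iso.hom) ≫ R.map (c.ι.app i₁).snd =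
          (X.iso.hom ≫ R.map a₂) ≫ R.map (c.ι.app i₂).snd := by
        rw [Category.assoc, Category.assoc, ← R.map_comp, ha₂, ← f.w, ← ha₁, L.map_comp,
          Category.assoc]
        exact congrArg (L.map a₁ ≫ ·) (c.ι.app i₁).w.symm
      obtain ⟨j, p, q, h⟩ : ∃ (j : J) (p : i₁ ⟶ j) (q : i₂ ⟶ j),
          (L.map a₁ ≫ (K.obj i₁).iso.hom) ≫ R.map (K.map p).snd =
            (X.iso.hom ≫ R.map a₂) ≫ R.map (K.map q).snd :=
        IsCardinalPresentable.exists_eq_of_isColimit κ h₃ _ _ e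
      refine ⟨j, (⟨a₁ ≫ (K.map p).fst, a₂ ≫ (K.map q).snd, ?_⟩ : X ⟶ K.obj j), ?_⟩
      · rw [L.map_comp, Category.assoc, (K.map p).w, R.map_comp, ← Category.assoc, h,
          Category.assoc]
      · have e₁ : (K.map p).fst ≫ (c.ι.app j).fst = (c.ι.app i₁).fst := congrArg Hom.fst (c.w p)
        have e₂ : (K.map q).snd ≫ (c.ι.app j).snd = (c.ι.app i₂).snd := congrArg Hom.snd (c.w q)
        apply hom_ext
        · exact ha₁.symm.trans ((congrArg (a₁ ≫ ·) e₁.symm).trans (Category.assoc _ _ _).symm)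
        · exact ha₂.symm.trans ((congrArg (a₂ ≫ ·) e₂.symm).trans (Category.assoc _ _ _).symm)
    · change X ⟶ K.obj j at f g
      change f ≫ c.ι.app j = g ≫ c.ι.app j at hfg
      obtain ⟨i₁, p, hp⟩ : ∃ (i : J) (p : j ⟶ i),
          f.fst ≫ (K.map p).fst = g.fst ≫ (K.map p).fst :=
        IsCardinalPresentable.exists_eq_of_isColimit' κ h₁ (i := j) f.fst g.fst
          (congrArg Hom.fst hfg)
      obtain ⟨i₂, q, hq⟩ : ∃ (i : J) (p : j ⟶ i),
          f.snd ≫ (K.map p).snd = g.snd ≫ (K.map p).snd :=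
        IsCardinalPresentable.exists_eq_of_isColimit' κ h₂ (i := j) f.snd g.snd
          (congrArg Hom.snd hfg)
      obtain ⟨k, a, b, hab⟩ := IsFiltered.span p q
      refine ⟨k, p ≫ a, ?_⟩
      change f ≫ K.map (p ≫ a) = g ≫ K.map (p ≫ a)
      ext
      · simp only [K.map_comp, comp_fst, reassoc_of% hp]
      · simp only [hab, K.map_comp, comp_snd, reassoc_of% hq]⟩⟩⟩

end Presentable

end CategoryTheory.Limits.CategoricalPullback

/-! ### Approximation by objects with presentable components. -/

namespace CategoryTheory

section

variable {A : Type u₁} [Category.{v₁} A] {γ : Type w} [Preorder γ]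
  {κ : Cardinal.{w}} [Fact κ.IsRegular] [IsCardinalFiltered γ κ]
  {X : A} (p : ColimitPresentation γ X)

/-- Holding for all large `a`, the conclusion can be imposed on both components at one common index.
-/
lemma exists_factorization_of_colimitPresentation {K : Type w} (hK : HasCardinalLT K κ) (Z : K → A)
    (hZ : ∀ k, IsCardinalPresentable (Z k) κ) (g : ∀ k, Z k ⟶ X) :
    ∃ a₀, ∀ a, a₀ ≤ a → ∃ α : ∀ k, Z k ⟶ p.diag.obj a, ∀ k, α k ≫ p.ι.app a = g k := by
  have h (k : K) : ∃ (b : γ) (α : Z k ⟶ p.diag.obj b), α ≫ p.ι.app b = g k :=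
    IsCardinalPresentable.exists_hom_of_isColimit κ p.isColimit (g k)
  choose b α hα using h
  obtain ⟨a₀, ha₀⟩ := exists_upper_bound_of_isCardinalFiltered hK b
  refine ⟨a₀, fun a ha ↦ ⟨fun k ↦ α k ≫ p.diag.map (homOfLE ((ha₀ k).trans ha)), fun k ↦ ?_⟩⟩
  rw [Category.assoc, p.w, hα]

lemma exists_coequalizing_factorization_of_colimitPresentation {K : Type w}
    (hK : HasCardinalLT K κ) {P Z : A} (hP : IsCardinalPresentable P κ)
    (hZ : IsCardinalPresentable Z κ) (g : Z ⟶ X) (f : K → (P ⟶ Z))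
    (hf : ∀ k l, f k ≫ g = f l ≫ g) :
    ∃ a₀, ∀ a, a₀ ≤ a → ∃ α : Z ⟶ p.diag.obj a, α ≫ p.ι.app a = g ∧
      ∀ k l, f k ≫ α = f l ≫ α := by
  obtain ⟨b, α, hα⟩ : ∃ (b : γ) (α : Z ⟶ p.diag.obj b), α ≫ p.ι.app b = g :=
    IsCardinalPresentable.exists_hom_of_isColimit κ p.isColimit g
  have h (x : K × K) : ∃ (r : γ) (h₁ : b ≤ r) (h₂ : b ≤ r),
      (f x.1 ≫ α) ≫ p.diag.map (homOfLE h₁) = (f x.2 ≫ α) ≫ p.diag.map (homOfLE h₂) :=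
    exists_comp_map_homOfLE_eq p.isColimit hP _ _ (by
      change (f x.1 ≫ α) ≫ p.ι.app b = (f x.2 ≫ α) ≫ p.ι.app b
      rw [Category.assoc, Category.assoc, hα, hf])
  choose r hr _ hr' using h
  have hκ : Cardinal.aleph0 ≤ κ := Cardinal.IsRegular.aleph0_le Fact.out
  obtain ⟨a₁, ha₁⟩ := exists_upper_bound_of_isCardinalFiltered (hasCardinalLT_prod hκ hK hK) r
  obtain ⟨a₀, h₁, h₂⟩ := exists_upper_bound_pair κ a₁ b
  refine ⟨a₀, fun a ha ↦ ⟨α ≫ p.diag.map (homOfLE (h₂.trans ha)), ?_, fun k l ↦ ?_⟩⟩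
  · rw [Category.assoc, p.w, hα]
  · have := comp_map_homOfLE_eq_of_le (hr' (k, l)) ((ha₁ (k, l)).trans (h₁.trans ha))
    simpa only [Category.assoc] using this

end

namespace Limits.CategoricalPullback

variable {A : Type u₁} [Category.{v₁} A] {B : Type u₂} [Category.{v₂} B]
  {C : Type u₃} [Category.{v₃} C] {L : A ⥤ C} {R : B ⥤ C}
  {γ : Type w} [Preorder γ] {κ : Cardinal.{w}} [Fact κ.IsRegular] [IsCardinalFiltered γ κ]
  {X : CategoricalPullback L R} (p : ColimitPresentation γ X.fst) (q : ColimitPresentation γ X.snd)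
  [PreservesColimitsOfShape γ L] [PreservesColimitsOfShape γ R]
  (hL : ∀ a, IsCardinalPresentable (L.obj (p.diag.obj a)) κ)
  (hR : ∀ a, IsCardinalPresentable (R.obj (q.diag.obj a)) κ)
  (hp : ∀ a, IsCardinalPresentable (p.diag.obj a) κ)
  (hq : ∀ a, IsCardinalPresentable (q.diag.obj a) κ)
  (I : Type w) [LinearOrder I] [WellFoundedLT I] [NoMaxOrder I] [Nonempty I]
  [HasColimitsOfShape I A] [HasColimitsOfShape I B]
  [PreservesColimitsOfShape I L] [PreservesColimitsOfShape I R]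
  [LocallySmall.{w} A] [LocallySmall.{w} B]

include hL hR hp hq in
-- The object `Y` is the colimit of an interleaving chain. Prescribing `u` makes its isomorphism
-- agree with a chosen restriction of that of `X`, which lets other objects map to `Y`.
lemma exists_hom_of_map_hom (hI : HasCardinalLT I κ) {a₀ b₀ : γ} (h₀ : a₀ ≤ b₀)
    (u : L.obj (p.diag.obj a₀) ⟶ R.obj (q.diag.obj b₀))
    (hu : u ≫ R.map (q.ι.app b₀) = L.map (p.ι.app a₀) ≫ X.iso.hom) :
    ∃ (Y : CategoricalPullback L R) (_ : IsCardinalPresentable Y.fst κ)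
      (_ : IsCardinalPresentable Y.snd κ) (f : Y ⟶ X) (α : p.diag.obj a₀ ⟶ Y.fst)
      (β : q.diag.obj b₀ ⟶ Y.snd), α ≫ f.fst = p.ι.app a₀ ∧ β ≫ f.snd = q.ι.app b₀ ∧
        L.map α ≫ Y.iso.hom = u ≫ R.map β := by
  obtain ⟨s, hs, hs₀, S, T, hST, hTS, hι, hinit⟩ := exists_chain_shift
    (F := p.diag ⋙ L) (G := q.diag ⋙ R)
    (isColimitOfPreserves L p.isColimit) (isColimitOfPreserves R q.isColimit) X.iso hL hR hI h₀ u hu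
  -- Arrows of a poset are determined by their endpoints.
  have hI' : HasCardinalLT (Arrow I) κ :=
    (hasCardinalLT_prod (Cardinal.IsRegular.aleph0_le Fact.out) hI hI).of_injective
      (fun f : Arrow I ↦ (f.left, f.right)) (by
        rintro ⟨a, b, f⟩ ⟨a', b', f'⟩ h
        obtain ⟨rfl, rfl⟩ := Prod.mk.inj h
        obtain rfl : f = f' := Subsingleton.elim (α := a ⟶ b) f f'
        rfl)
  let c := colimit.cocone (hs.functor ⋙ p.diag)
  have hc : IsColimit c := colimit.isColimit _
  let d := colimit.cocone (hs.functor ⋙ q.diag)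
  have hd : IsColimit d := colimit.isColimit _
  let c' : Cocone (hs.functor ⋙ p.diag ⋙ L) := L.mapCocone c
  have hc' : IsColimit c' := isColimitOfPreserves L hc
  let d' : Cocone (hs.functor ⋙ q.diag ⋙ R) := R.mapCocone d
  have hd' : IsColimit d' := isColimitOfPreserves R hd
  have (i : I) : IsCardinalPresentable ((hs.functor ⋙ p.diag).obj i) κ := hp (s i)
  have (i : I) : IsCardinalPresentable ((hs.functor ⋙ q.diag).obj i) κ := hq (s i)
  have hc₀ : IsCardinalPresentable c.pt κ := isCardinalPresentable_of_isColimit c hc κ hI'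
  have hd₀ : IsCardinalPresentable d.pt κ := isCardinalPresentable_of_isColimit d hd κ hI'
  obtain ⟨φ, hφ⟩ : ∃ φ : c.pt ⟶ X.fst, ∀ i, c.ι.app i ≫ φ = p.ι.app (s i) :=
    ⟨hc.desc ⟨X.fst, Functor.whiskerLeft hs.functor p.ι⟩, fun i ↦ hc.fac _ i⟩
  obtain ⟨ψ, hψ⟩ : ∃ ψ : d.pt ⟶ X.snd, ∀ i, d.ι.app i ≫ ψ = q.ι.app (s i) :=
    ⟨hd.desc ⟨X.snd, Functor.whiskerLeft hs.functor q.ι⟩, fun i ↦ hd.fac _ i⟩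
  let e : L.obj c.pt ≅ R.obj d.pt := S.iso T hST hTS hc' hd'
  have he {i j : I} (h : i < j) : L.map (c.ι.app i) ≫ e.hom = S.hom h ≫ R.map (d.ι.app j) :=
    S.ι_desc hc' d' h
  let Y : CategoricalPullback L R := ⟨c.pt, d.pt, e⟩
  have w : L.map φ ≫ X.iso.hom = e.hom ≫ R.map ψ := hc'.hom_ext fun i ↦ by
    obtain ⟨j, hj⟩ := exists_gt i
    have h₁ : L.map (c.ι.app i) ≫ L.map φ ≫ X.iso.hom = L.map (p.ι.app (s i)) ≫ X.iso.hom := by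
      rw [← L.map_comp_assoc, hφ]
      rfl
    have h₂ : L.map (c.ι.app i) ≫ e.hom ≫ R.map ψ = S.hom hj ≫ R.map (q.ι.app (s j)) := by
      rw [← hψ, R.map_comp, ← Category.assoc, he hj, Category.assoc]
    exact h₁.trans ((hι hj).symm.trans h₂.symm)
  obtain ⟨i, j, a, b, v, ha, hb, hv, hv₀⟩ : ∃ (i j : I) (a : p.diag.obj (s i) ⟶ c.pt)
      (b : q.diag.obj (s j) ⟶ d.pt) (v : L.obj (p.diag.obj (s i)) ⟶ R.obj (q.diag.obj (s j))),
      a ≫ φ = p.ι.app (s i) ∧ b ≫ ψ = q.ι.app (s j) ∧ L.map a ≫ e.hom = v ≫ R.map b ∧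
        L.map (p.diag.map (homOfLE (h₀.trans (hs₀ i)))) ≫ v =
          u ≫ R.map (q.diag.map (homOfLE (hs₀ j))) := by
    obtain ⟨i⟩ : Nonempty I := inferInstance
    obtain ⟨j, hj⟩ := exists_gt i
    exact ⟨i, j, c.ι.app i, d.ι.app j, S.hom hj, hφ i, hψ j, he hj, hinit hj⟩
  refine ⟨Y, hc₀, hd₀, ⟨φ, ψ, w⟩, p.diag.map (homOfLE (h₀.trans (hs₀ i))) ≫ a,
    q.diag.map (homOfLE (hs₀ j)) ≫ b, ?_, ?_, ?_⟩
  · rw [Category.assoc, ha, p.w]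
  · rw [Category.assoc, hb, q.w]
  · change L.map (_ ≫ a) ≫ e.hom = _
    rw [L.map_comp, R.map_comp, Category.assoc, hv, ← Category.assoc, hv₀, Category.assoc]

include hL hR hp hq in
-- Compatibility of the component factorizations with the isomorphisms holds after mapping to the
-- colimit, so by presentability it holds at a stage `t`, common to fewer than κ indices. The chain
-- is then started from the map restricted to `t`.
lemma exists_hom_of_factorization (hI : HasCardinalLT I κ) {K : Type w} (hK : HasCardinalLT K κ)
    (Z : K → CategoricalPullback L R) (hZ : ∀ k, IsCardinalPresentable (L.obj (Z k).fst) κ)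
    (g : ∀ k, Z k ⟶ X) (a : γ) (α : ∀ k, (Z k).fst ⟶ p.diag.obj a)
    (hα : ∀ k, α k ≫ p.ι.app a = (g k).fst) (β : ∀ k, (Z k).snd ⟶ q.diag.obj a)
    (hβ : ∀ k, β k ≫ q.ι.app a = (g k).snd) :
    ∃ (Y : CategoricalPullback L R) (_ : IsCardinalPresentable Y.fst κ)
      (_ : IsCardinalPresentable Y.snd κ) (f : Y ⟶ X) (φ : p.diag.obj a ⟶ Y.fst)
      (ψ : q.diag.obj a ⟶ Y.snd) (h : ∀ k, Z k ⟶ Y), φ ≫ f.fst = p.ι.app a ∧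
        ψ ≫ f.snd = q.ι.app a ∧ ∀ k, (h k).fst = α k ≫ φ ∧ (h k).snd = β k ≫ ψ ∧
          h k ≫ f = g k := by
  have hRq := isColimitOfPreserves R q.isColimit
  obtain ⟨b, hab, u, hu⟩ : ∃ (b : γ) (_ : a ≤ b) (u : L.obj (p.diag.obj a) ⟶ R.obj (q.diag.obj b)),
      u ≫ R.map (q.ι.app b) = L.map (p.ι.app a) ≫ X.iso.hom :=
    exists_comp_ι_eq hRq (hL a) _ a
  have aux (k : K) : ∃ (r : γ) (h₁ : b ≤ r) (h₂ : a ≤ r),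
      (L.map (α k) ≫ u) ≫ R.map (q.diag.map (homOfLE h₁)) =
        ((Z k).iso.hom ≫ R.map (β k)) ≫ R.map (q.diag.map (homOfLE h₂)) :=
    exists_comp_map_homOfLE_eq hRq (hZ k) _ _ (by
      change (L.map (α k) ≫ u) ≫ R.map (q.ι.app b) =
        ((Z k).iso.hom ≫ R.map (β k)) ≫ R.map (q.ι.app a)
      rw [Category.assoc, hu, Category.assoc, ← R.map_comp, hβ, ← L.map_comp_assoc, hα, (g k).w])
  choose r hr₁ hr₂ hr using aux
  obtain ⟨t₁, ht₁⟩ := exists_upper_bound_of_isCardinalFiltered hK r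
  obtain ⟨t, ht, hbt⟩ := exists_upper_bound_pair κ t₁ b
  have hr' (k : K) : (L.map (α k) ≫ u) ≫ R.map (q.diag.map (homOfLE hbt)) =
      ((Z k).iso.hom ≫ R.map (β k)) ≫ R.map (q.diag.map (homOfLE (hab.trans hbt))) :=
    comp_map_homOfLE_eq_of_le (G := q.diag ⋙ R) (hr k) ((ht₁ k).trans ht)
  obtain ⟨Y, hY₁, hY₂, f, φ, ψ, hφ, hψ, h⟩ := exists_hom_of_map_hom p q hL hR hp hq I hI
    (hab.trans hbt) (u ≫ R.map (q.diag.map (homOfLE hbt))) (by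
      rw [Category.assoc, ← R.map_comp, q.w, hu])
  have hψ' : (q.diag.map (homOfLE (hab.trans hbt)) ≫ ψ) ≫ f.snd = q.ι.app a := by
    rw [Category.assoc, hψ, q.w]
  refine ⟨Y, hY₁, hY₂, f, φ, q.diag.map (homOfLE (hab.trans hbt)) ≫ ψ, fun k ↦
    { fst := α k ≫ φ
      snd := β k ≫ q.diag.map (homOfLE (hab.trans hbt)) ≫ ψ
      w := ?_ }, hφ, hψ', fun k ↦ ⟨rfl, rfl, ?_⟩⟩
  · have := hr' k =≫ R.map ψ
    simp only [Category.assoc] at this h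
    simp only [L.map_comp, R.map_comp, Category.assoc, h, this]
  · ext
    · rw [comp_fst, Category.assoc, hφ, hα]
    · rw [comp_snd, Category.assoc, hψ', hβ]

end Limits.CategoricalPullback

end CategoryTheory

/-! ### Filtered comma categories and final projections. -/

namespace CategoryTheory.Limits.CategoricalPullback

/-- The object of the comma category of a full subcategory determined by a morphism. -/
abbrev objOver {D : Type u₁} [Category.{v₁} D] {P : ObjectProperty D} {X Y : D} (hY : P Y)
    (f : Y ⟶ X) : CostructuredArrow P.ι X :=
  CostructuredArrow.mk (S := P.ι) (Y := ⟨Y, hY⟩) (show P.ι.obj ⟨Y, hY⟩ ⟶ X from f)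

variable {A : Type u₁} [Category.{v₁} A] {B : Type u₂} [Category.{v₂} B]
  {C : Type u₃} [Category.{v₃} C] {L : A ⥤ C} {R : B ⥤ C}
  {κ : Cardinal.{w}} [Fact κ.IsRegular]

/-- Any two objects of `κ`-accessible categories are colimits of `κ`-presentable objects
indexed by the same `κ`-directed partially ordered set. -/
lemma exists_directed_colimitPresentations [IsCardinalAccessibleCategory A κ]
    [IsCardinalAccessibleCategory B κ] (X : A) (Y : B) :
    ∃ (γ : Type w) (_ : PartialOrder γ) (_ : IsCardinalFiltered γ κ)
      (p : ColimitPresentation γ X) (q : ColimitPresentation γ Y),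
      (∀ a, IsCardinalPresentable (p.diag.obj a) κ) ∧
        ∀ a, IsCardinalPresentable (q.diag.obj a) κ := by
  obtain ⟨J₁, _, _, ⟨p⟩⟩ :=
    (isCardinalFilteredGenerator_isCardinalPresentable A κ).exists_colimitsOfShape X
  obtain ⟨J₂, _, _, ⟨q⟩⟩ :=
    (isCardinalFilteredGenerator_isCardinalPresentable B κ).exists_colimitsOfShape Y
  -- A directed poset final in the product serves both diagrams, since the projections of a product
  -- of filtered categories are final.
  obtain ⟨γ, _, _, F, _⟩ := IsCardinalFiltered.exists_cardinal_directed (J₁ × J₂) κ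
  have := isFiltered_of_isCardinalFiltered J₁ κ
  have := isFiltered_of_isCardinalFiltered J₂ κ
  exact ⟨γ, _, inferInstance, p.toColimitPresentation.reindex (F ⋙ Prod.fst _ _),
    q.toColimitPresentation.reindex (F ⋙ Prod.snd _ _),
    fun a ↦ p.prop_diag_obj _, fun a ↦ q.prop_diag_obj _⟩

variable [IsCardinalAccessibleCategory A κ] [IsCardinalAccessibleCategory B κ]
  [L.IsCardinalAccessible κ] [R.IsCardinalAccessible κ]
  (hL : ∀ X : A, IsCardinalPresentable X κ → IsCardinalPresentable (L.obj X) κ)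
  (hR : ∀ X : B, IsCardinalPresentable X κ → IsCardinalPresentable (R.obj X) κ)
  (I : Type w) [LinearOrder I] [WellFoundedLT I] [NoMaxOrder I] [Nonempty I]
  [HasColimitsOfShape I A] [HasColimitsOfShape I B]
  [PreservesColimitsOfShape I L] [PreservesColimitsOfShape I R]
  (hI : HasCardinalLT I κ) (X : CategoricalPullback L R)

variable (L R κ) in
/-- The objects of a categorical pullback both of whose components are `κ`-presentable. -/
def presentableComponents : ObjectProperty (CategoricalPullback L R) :=
  (isCardinalPresentable A κ).inverseImage (π₁ L R) ⊓
    (isCardinalPresentable B κ).inverseImage (π₂ L R)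

include hL hR hI in
lemma exists_upper_bound {K : Type w} (hK : HasCardinalLT K κ) (Z : K → CategoricalPullback L R)
    (hZ : ∀ k, presentableComponents L R κ (Z k)) (g : ∀ k, Z k ⟶ X) :
    ∃ (Y : CategoricalPullback L R) (_ : presentableComponents L R κ Y) (f : Y ⟶ X),
      ∀ k, ∃ h : Z k ⟶ Y, h ≫ f = g k := by
  obtain ⟨γ, _, _, p, q, hp, hq⟩ := exists_directed_colimitPresentations (κ := κ) X.fst X.snd
  have := L.preservesColimitsOfShape_of_isCardinalAccessible κ γ
  have := R.preservesColimitsOfShape_of_isCardinalAccessible κ γ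
  obtain ⟨a₁, h₁⟩ := exists_factorization_of_colimitPresentation p hK (fun k ↦ (Z k).fst)
    (fun k ↦ (hZ k).1) (fun k ↦ (g k).fst)
  obtain ⟨a₂, h₂⟩ := exists_factorization_of_colimitPresentation q hK (fun k ↦ (Z k).snd)
    (fun k ↦ (hZ k).2) (fun k ↦ (g k).snd)
  obtain ⟨a, ha₁, ha₂⟩ := exists_upper_bound_pair κ a₁ a₂
  obtain ⟨α, hα⟩ := h₁ a ha₁
  obtain ⟨β, hβ⟩ := h₂ a ha₂
  obtain ⟨Y, hY₁, hY₂, f, _, _, h, _, _, hh⟩ := exists_hom_of_factorization p q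
    (fun _ ↦ hL _ (hp _)) (fun _ ↦ hR _ (hq _)) hp hq I hI hK Z (fun k ↦ hL _ (hZ k).1) g a
    α hα β hβ
  exact ⟨Y, ⟨hY₁, hY₂⟩, f, fun k ↦ ⟨h k, (hh k).2.2⟩⟩

include hL hR hI in
lemma exists_coequalizing {K₁ K₂ : Type w} (hK₁ : HasCardinalLT K₁ κ) (hK₂ : HasCardinalLT K₂ κ)
    {Z : CategoricalPullback L R} (hZ : presentableComponents L R κ Z) (g : Z ⟶ X)
    {P : A} (hP : IsCardinalPresentable P κ) (s : K₁ → (P ⟶ Z.fst))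
    (hs : ∀ k l, s k ≫ g.fst = s l ≫ g.fst)
    {Q : B} (hQ : IsCardinalPresentable Q κ) (t : K₂ → (Q ⟶ Z.snd))
    (ht : ∀ k l, t k ≫ g.snd = t l ≫ g.snd) :
    ∃ (Y : CategoricalPullback L R) (_ : presentableComponents L R κ Y) (f : Y ⟶ X)
      (h : Z ⟶ Y), h ≫ f = g ∧ (∀ k l, s k ≫ h.fst = s l ≫ h.fst) ∧
        ∀ k l, t k ≫ h.snd = t l ≫ h.snd := by
  obtain ⟨γ, _, _, p, q, hp, hq⟩ := exists_directed_colimitPresentations (κ := κ) X.fst X.snd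
  have := L.preservesColimitsOfShape_of_isCardinalAccessible κ γ
  have := R.preservesColimitsOfShape_of_isCardinalAccessible κ γ
  obtain ⟨a₁, h₁⟩ := exists_coequalizing_factorization_of_colimitPresentation p hK₁ hP
    hZ.1 g.fst s hs
  obtain ⟨a₂, h₂⟩ := exists_coequalizing_factorization_of_colimitPresentation q hK₂ hQ
    hZ.2 g.snd t ht
  obtain ⟨a, ha₁, ha₂⟩ := exists_upper_bound_pair κ a₁ a₂
  obtain ⟨α, hα, hsα⟩ : ∃ α : Z.fst ⟶ p.diag.obj a, α ≫ p.ι.app a = g.fst ∧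
    ∀ k l, s k ≫ α = s l ≫ α := h₁ a ha₁
  obtain ⟨β, hβ, htβ⟩ : ∃ β : Z.snd ⟶ q.diag.obj a, β ≫ q.ι.app a = g.snd ∧
    ∀ k l, t k ≫ β = t l ≫ β := h₂ a ha₂
  obtain ⟨Y, hY₁, hY₂, f, φ, ψ, h, _, _, hh⟩ := exists_hom_of_factorization p q
    (fun _ ↦ hL _ (hp _)) (fun _ ↦ hR _ (hq _)) hp hq I hI
    (hasCardinalLT_of_finite PUnit.{w + 1} κ (Cardinal.IsRegular.aleph0_le Fact.out))
    (fun _ ↦ Z) (fun _ ↦ hL _ hZ.1) (fun _ ↦ g) a (fun _ ↦ α) (fun _ ↦ hα) (fun _ ↦ β)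
    (fun _ ↦ hβ)
  obtain ⟨e₁, e₂, e₃⟩ := hh ⟨⟩
  refine ⟨Y, ⟨hY₁, hY₂⟩, f, h ⟨⟩, e₃, fun k l ↦ ?_, fun k l ↦ ?_⟩
  · rw [e₁, ← Category.assoc, hsα k l, Category.assoc]
  · rw [e₂, ← Category.assoc, htβ k l, Category.assoc]

include hL hR hI in
lemma exists_factorization_proj {P : A} (hP : IsCardinalPresentable P κ) (s : P ⟶ X.fst)
    {Q : B} (hQ : IsCardinalPresentable Q κ) (t : Q ⟶ X.snd) :
    ∃ (Y : CategoricalPullback L R) (_ : presentableComponents L R κ Y) (f : Y ⟶ X)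
      (s' : P ⟶ Y.fst) (t' : Q ⟶ Y.snd), s' ≫ f.fst = s ∧ t' ≫ f.snd = t := by
  obtain ⟨γ, _, _, p, q, hp, hq⟩ := exists_directed_colimitPresentations (κ := κ) X.fst X.snd
  have := L.preservesColimitsOfShape_of_isCardinalAccessible κ γ
  have := R.preservesColimitsOfShape_of_isCardinalAccessible κ γ
  have hκ : Cardinal.aleph0 ≤ κ := Cardinal.IsRegular.aleph0_le Fact.out
  obtain ⟨a₁, h₁⟩ := exists_factorization_of_colimitPresentation p
    (hasCardinalLT_of_finite PUnit.{w + 1} κ hκ) (fun _ ↦ P) (fun _ ↦ hP) (fun _ ↦ s)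
  obtain ⟨a₂, h₂⟩ := exists_factorization_of_colimitPresentation q
    (hasCardinalLT_of_finite PUnit.{w + 1} κ hκ) (fun _ ↦ Q) (fun _ ↦ hQ) (fun _ ↦ t)
  obtain ⟨a, ha₁, ha₂⟩ := exists_upper_bound_pair κ a₁ a₂
  obtain ⟨α, hα⟩ := h₁ a ha₁
  obtain ⟨β, hβ⟩ := h₂ a ha₂
  obtain ⟨Y, hY₁, hY₂, f, φ, ψ, _, hφ, hψ, _⟩ := exists_hom_of_factorization p q
    (fun _ ↦ hL _ (hp _)) (fun _ ↦ hR _ (hq _)) hp hq I hI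
    -- No object has to be mapped to `Y`; only the components are constrained.
    (hasCardinalLT_of_finite PEmpty.{w + 1} κ hκ) (fun x ↦ x.elim) (fun x ↦ x.elim)
    (fun x ↦ x.elim) a (fun x ↦ x.elim) (fun x ↦ x.elim) (fun x ↦ x.elim) (fun x ↦ x.elim)
  exact ⟨Y, ⟨hY₁, hY₂⟩, f, α ⟨⟩ ≫ φ, β ⟨⟩ ≫ ψ, by rw [Category.assoc, hφ, hα],
    by rw [Category.assoc, hψ, hβ]⟩

include hL hR hI in
lemma isCardinalFiltered_costructuredArrow :
    IsCardinalFiltered (CostructuredArrow (presentableComponents L R κ).ι X) κ := by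
  rw [isCardinalFiltered_iff]
  have ub {ι : Type w} (hι : HasCardinalLT ι κ)
      (j : ι → CostructuredArrow (presentableComponents L R κ).ι X) :
      ∃ k, ∀ i, Nonempty (j i ⟶ k) := by
    obtain ⟨Y, hY, f, h⟩ := exists_upper_bound hL hR I hI X hι (fun i ↦ (j i).left.obj)
      (fun i ↦ (j i).left.property) (fun i ↦ (j i).hom)
    refine ⟨objOver hY f, fun i ↦ ?_⟩
    obtain ⟨h, e⟩ := h i
    exact ⟨CostructuredArrow.homMk (ObjectProperty.homMk h) e⟩
  refine ⟨fun ι j hι ↦ ub hι j, fun ι j k f hι ↦ ?_⟩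
  by_cases hne : Nonempty ι
  · obtain ⟨i⟩ := hne
    have w (i : ι) : (f i).left.hom ≫ k.hom = j.hom := CostructuredArrow.w (f i)
    obtain ⟨Y, hY, g, h, e, h₁, h₂⟩ := exists_coequalizing hL hR I hI X hι hι
      k.left.property k.hom j.left.property.1 (fun i ↦ (f i).left.hom.fst)
      (fun i i' ↦ congrArg Hom.fst ((w i).trans (w i').symm))
      j.left.property.2 (fun i ↦ (f i).left.hom.snd)
      (fun i i' ↦ congrArg Hom.snd ((w i).trans (w i').symm))
    let a : k ⟶ objOver hY g :=
      CostructuredArrow.homMk (ObjectProperty.homMk h) e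
    -- All composites with `a` coincide, so any `i` gives the common value; this needs a nonempty
    -- family.
    refine ⟨_, a, f i ≫ a, fun i' ↦ ?_⟩
    apply CostructuredArrow.hom_ext
    apply ObjectProperty.hom_ext
    exact hom_ext (h₁ i' i) (h₂ i' i)
  · obtain ⟨l, hl⟩ := ub (hasCardinalLT_of_finite (ULift.{w} Bool) κ
      (Cardinal.IsRegular.aleph0_le Fact.out)) (fun x ↦ cond x.down j k)
    exact ⟨l, (hl ⟨false⟩).some, (hl ⟨true⟩).some, fun i ↦ (hne ⟨i⟩).elim⟩

variable (L R κ) in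
/-- The first projection between the comma categories of presentable objects. -/
def costructuredArrowπ₁ : CostructuredArrow (presentableComponents L R κ).ι X ⥤
    CostructuredArrow (isCardinalPresentable A κ).ι X.fst where
  obj Y := objOver Y.left.property.1 Y.hom.fst
  map f := CostructuredArrow.homMk (ObjectProperty.homMk f.left.hom.fst)
    (congrArg Hom.fst (CostructuredArrow.w f))

variable (L R κ) in
/-- The second projection between the comma categories of presentable objects. -/
def costructuredArrowπ₂ : CostructuredArrow (presentableComponents L R κ).ι X ⥤
    CostructuredArrow (isCardinalPresentable B κ).ι X.snd where
  obj Y := objOver Y.left.property.2 Y.hom.snd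
  map f := CostructuredArrow.homMk (ObjectProperty.homMk f.left.hom.snd)
    (congrArg Hom.snd (CostructuredArrow.w f))

include hL hR hI in
lemma final_costructuredArrowπ₁ : (costructuredArrowπ₁ L R κ X).Final := by
  have := isCardinalFiltered_costructuredArrow hL hR I hI X
  have := isFiltered_of_isCardinalFiltered
    (CostructuredArrow (presentableComponents L R κ).ι X) κ
  have hκ : Cardinal.aleph0 ≤ κ := Cardinal.IsRegular.aleph0_le Fact.out
  rw [Functor.final_iff_of_isFiltered]
  refine ⟨fun d ↦ ?_, fun {d c} s s' ↦ ?_⟩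
  -- An arbitrary presentable object over the second component fills the unconstrained slot.
  · obtain ⟨e⟩ := IsCardinalFiltered.nonempty
      (CostructuredArrow (isCardinalPresentable B κ).ι X.snd) κ
    obtain ⟨Y, hY, f, a, _, ha, _⟩ := exists_factorization_proj hL hR I hI X
      d.left.property d.hom e.left.property e.hom
    exact ⟨objOver hY f,
      ⟨CostructuredArrow.homMk (ObjectProperty.homMk a) ha⟩⟩
  · have hs (b : ULift.{w} Bool) : (cond b.down s s').left.hom ≫ c.hom.fst = d.hom :=
      CostructuredArrow.w (cond b.down s s')
    obtain ⟨Y, hY, g, h, e, h₁, _⟩ := exists_coequalizing hL hR I hI X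
      (hasCardinalLT_of_finite (ULift.{w} Bool) κ hκ)
      (hasCardinalLT_of_finite PEmpty.{w + 1} κ hκ) c.left.property c.hom
      d.left.property (fun b ↦ (cond b.down s s').left.hom)
      (fun b b' ↦ (hs b).trans (hs b').symm) (Q := c.left.obj.snd) c.left.property.2
      (fun x ↦ x.elim) (fun x ↦ x.elim)
    refine ⟨objOver hY g,
      CostructuredArrow.homMk (ObjectProperty.homMk h) e, ?_⟩
    apply CostructuredArrow.hom_ext
    apply ObjectProperty.hom_ext
    exact h₁ ⟨true⟩ ⟨false⟩

include hL hR hI in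
lemma final_costructuredArrowπ₂ : (costructuredArrowπ₂ L R κ X).Final := by
  have := isCardinalFiltered_costructuredArrow hL hR I hI X
  have := isFiltered_of_isCardinalFiltered
    (CostructuredArrow (presentableComponents L R κ).ι X) κ
  have hκ : Cardinal.aleph0 ≤ κ := Cardinal.IsRegular.aleph0_le Fact.out
  rw [Functor.final_iff_of_isFiltered]
  refine ⟨fun d ↦ ?_, fun {d c} s s' ↦ ?_⟩
  · obtain ⟨e⟩ := IsCardinalFiltered.nonempty
      (CostructuredArrow (isCardinalPresentable A κ).ι X.fst) κ
    obtain ⟨Y, hY, f, _, b, _, hb⟩ := exists_factorization_proj hL hR I hI X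
      e.left.property e.hom d.left.property d.hom
    exact ⟨objOver hY f,
      ⟨CostructuredArrow.homMk (ObjectProperty.homMk b) hb⟩⟩
  · have hs (b : ULift.{w} Bool) : (cond b.down s s').left.hom ≫ c.hom.snd = d.hom :=
      CostructuredArrow.w (cond b.down s s')
    obtain ⟨Y, hY, g, h, e, _, h₂⟩ := exists_coequalizing hL hR I hI X
      (hasCardinalLT_of_finite PEmpty.{w + 1} κ hκ)
      (hasCardinalLT_of_finite (ULift.{w} Bool) κ hκ) c.left.property c.hom
      (P := c.left.obj.fst) c.left.property.1 (fun x ↦ x.elim) (fun x ↦ x.elim)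
      d.left.property (fun b ↦ (cond b.down s s').left.hom)
      (fun b b' ↦ (hs b).trans (hs b').symm)
    refine ⟨objOver hY g,
      CostructuredArrow.homMk (ObjectProperty.homMk h) e, ?_⟩
    apply CostructuredArrow.hom_ext
    apply ObjectProperty.hom_ext
    exact h₂ ⟨true⟩ ⟨false⟩

end CategoryTheory.Limits.CategoricalPullback

/-! ### Canonical colimits and accessibility. -/

namespace CategoryTheory.Limits.CategoricalPullback

variable {A : Type u₁} [Category.{v₁} A] {B : Type u₂} [Category.{v₂} B]
  {C : Type u₃} [Category.{v₃} C] {L : A ⥤ C} {R : B ⥤ C}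
  {κ : Cardinal.{w}} [Fact κ.IsRegular]
  [IsCardinalAccessibleCategory A κ] [IsCardinalAccessibleCategory B κ]
  [L.IsCardinalAccessible κ] [R.IsCardinalAccessible κ]
  (hL : ∀ X : A, IsCardinalPresentable X κ → IsCardinalPresentable (L.obj X) κ)
  (hR : ∀ X : B, IsCardinalPresentable X κ → IsCardinalPresentable (R.obj X) κ)
  (I : Type w) [LinearOrder I] [WellFoundedLT I] [NoMaxOrder I] [Nonempty I]
  [HasColimitsOfShape I A] [HasColimitsOfShape I B]
  [PreservesColimitsOfShape I L] [PreservesColimitsOfShape I R]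
  (hI : HasCardinalLT I κ)

instance [LocallySmall.{w} C] :
    ObjectProperty.EssentiallySmall.{w} (presentableComponents L R κ) :=
  essentiallySmall_inf_inverseImage _ _

variable (L R κ) in
/-- The canonical cocone on the objects with presentable components over a given object. -/
def canonicalCocone (X : CategoricalPullback L R) :
    Cocone (CostructuredArrow.proj (presentableComponents L R κ).ι X ⋙
      (presentableComponents L R κ).ι) where
  pt := X
  ι :=
    { app Y := Y.hom
      naturality _ _ f := (CostructuredArrow.w f).trans (Category.comp_id _).symm }

include hL hR hI in
lemma nonempty_isColimit_canonicalCocone [LocallySmall.{w} C] (X : CategoricalPullback L R) :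
    Nonempty (IsColimit (canonicalCocone L R κ X)) := by
  have := isCardinalFiltered_costructuredArrow hL hR I hI X
  have := L.preservesColimitsOfShape_of_isCardinalAccessible_of_essentiallySmall κ
    (CostructuredArrow (presentableComponents L R κ).ι X)
  have := final_costructuredArrowπ₁ hL hR I hI X
  have := final_costructuredArrowπ₂ hL hR I hI X
  -- Density of the presentables in each factor, restricted along a final functor, gives the colimit
  -- in each component.
  have h₁ := (Functor.Final.isColimitWhiskerEquiv (costructuredArrowπ₁ L R κ X) _).symm
    ((isCardinalPresentable A κ).ι.denseAt X.fst)
  have h₂ := (Functor.Final.isColimitWhiskerEquiv (costructuredArrowπ₂ L R κ X) _).symm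
    ((isCardinalPresentable B κ).ι.denseAt X.snd)
  exact ⟨isColimitOfProj (IsColimit.ofIsoColimit h₁ (Cocone.ext (Iso.refl _) fun _ ↦
      (Category.comp_id _).trans (Category.id_comp _)))
    (IsColimit.ofIsoColimit h₂ (Cocone.ext (Iso.refl _) fun _ ↦
      (Category.comp_id _).trans (Category.id_comp _)))⟩

include hL hR hI in
lemma isCardinalFilteredGenerator_presentableComponents [LocallySmall.{w} C] :
    (presentableComponents L R κ).IsCardinalFilteredGenerator κ where
  le_isCardinalPresentable X hX := by
    have : IsCardinalPresentable X.fst κ := hX.1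
    have : IsCardinalPresentable X.snd κ := hX.2
    have := hL X.fst hX.1
    exact isCardinalPresentable_of_proj κ X
  exists_colimitsOfShape X := by
    obtain ⟨h⟩ := nonempty_isColimit_canonicalCocone hL hR I hI X
    let e := equivSmallModel.{w} (CostructuredArrow (presentableComponents L R κ).ι X)
    have := isCardinalFiltered_costructuredArrow hL hR I hI X
    let p : ColimitPresentation (CostructuredArrow (presentableComponents L R κ).ι X) X :=
      ⟨_, (canonicalCocone L R κ X).ι, h⟩
    exact ⟨_, inferInstance, IsCardinalFiltered.of_equivalence κ e,
      ⟨{ toColimitPresentation := p.reindex e.inverse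
         prop_diag_obj j := (e.inverse.obj j).left.property }⟩⟩

include hL hR hI in
lemma isCardinalAccessibleCategory [LocallySmall.{w} C] :
    IsCardinalAccessibleCategory (CategoricalPullback L R) κ :=
  have := (isCardinalFilteredGenerator_presentableComponents hL hR I hI).hasCardinalFilteredGenerator
  have := hasCardinalFilteredColimits (L := L) (R := R) κ
  { }

include hL hR hI in
lemma isCardinalPresentable_iff_proj [LocallySmall.{w} C] (X : CategoricalPullback L R) :
    IsCardinalPresentable X κ ↔
      IsCardinalPresentable X.fst κ ∧ IsCardinalPresentable X.snd κ := by
  have hP := isCardinalFilteredGenerator_presentableComponents hL hR I hI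
  refine ⟨fun hX ↦ ?_, fun hX ↦ hP.le_isCardinalPresentable X hX⟩
  -- A presentable object is a retract of a generator, and functors preserve retracts.
  rw [← isCardinalPresentable_iff, hP.isPresentable_eq_retractClosure] at hX
  obtain ⟨Y, hY, ⟨r⟩⟩ := hX
  have : IsCardinalPresentable ((π₁ L R).obj Y) κ := hY.1
  have : IsCardinalPresentable ((π₂ L R).obj Y) κ := hY.2
  exact ⟨(r.map (π₁ L R)).isCardinalPresentable κ, (r.map (π₂ L R)).isCardinalPresentable κ⟩

end CategoryTheory.Limits.CategoricalPullback
theorem corollary4p1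
    (κ : Cardinal.{w}) [Fact κ.IsRegular]
    (lam : Cardinal.{w}) (hlam : Cardinal.aleph0 ≤ lam) (hlamκ : lam < κ)
    (A : Type u₁) [Category.{v₁} A] [IsCardinalAccessibleCategory A κ]
    [HasColimitsOfShape lam.ord.ToType A]
    (B : Type u₂) [Category.{v₂} B] [IsCardinalAccessibleCategory B κ]
    [HasColimitsOfShape lam.ord.ToType B]
    (C : Type u₃) [Category.{v₃} C] [IsCardinalAccessibleCategory C κ]
    [HasColimitsOfShape lam.ord.ToType C]
    (ΘA : A ⥤ C) [ΘA.IsCardinalAccessible κ] [PreservesColimitsOfShape lam.ord.ToType ΘA]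
    (hΘA : ∀ X : A, IsCardinalPresentable X κ → IsCardinalPresentable (ΘA.obj X) κ)
    (ΘB : B ⥤ C) [ΘB.IsCardinalAccessible κ] [PreservesColimitsOfShape lam.ord.ToType ΘB]
    (hΘB : ∀ Y : B, IsCardinalPresentable Y κ → IsCardinalPresentable (ΘB.obj Y) κ) :
    IsCardinalAccessibleCategory (CategoricalPullback ΘA ΘB) κ ∧
      ∀ X : CategoricalPullback ΘA ΘB,
        IsCardinalPresentable X κ ↔
          IsCardinalPresentable X.fst κ ∧ IsCardinalPresentable X.snd κ := by

  have hI : HasCardinalLT lam.ord.ToType κ := by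
    rwa [hasCardinalLT_iff_cardinal_mk_lt, Cardinal.mk_ord_toType]
  -- The initial ordinal of an infinite cardinal is a limit, as interleaving requires.
  have : NoMaxOrder lam.ord.ToType := Cardinal.noMaxOrder hlam
  have : Nonempty lam.ord.ToType := by
    rw [← Cardinal.mk_ne_zero_iff, Cardinal.mk_ord_toType]
    exact (Cardinal.aleph0_pos.trans_le hlam).ne'
  exact ⟨CategoricalPullback.isCardinalAccessibleCategory hΘA hΘB lam.ord.ToType hI,
    CategoricalPullback.isCardinalPresentable_iff_proj hΘA hΘB lam.ord.ToType hI⟩
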